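/- For $n\ge 0$ let $S_n$ be the symmetric group on $[n]=\{1,\dots,n\}$, with Coxeter generators the adjacent transpositions $(i\ \,i{+}1)$, $1\le i<n$. Let $S^B_n$ be the group of signed permutations of size $n$, i.e. of bijections $w$ of $[\pm n]=\{\pm1,\dots,\pm n\}$ with $w(-x)=-w(x)$ for all $x$; it is the Coxeter group of type B, with Coxeter generators $s_0=(1\ \,{-1})$ and $s_i=(i\ \,i{+}1)(-i\ \,{-(i{+}1)})$, $1\le i<n$. An element $w$ of one of these groups is called boolean if its principal order ideal $\{v : v\le w\}$ in the Bruhat order of the group is isomorphic, as a poset, to a boolean lattice (the lattice of all subsets of a finite set). A permutation $w\in S_n$ avoids $p\in S_k$ if there are no indices $i_1<\cdots<i_k$ in $[n]$ such that $w(i_1)\cdots w(i_k)$ is order-isomorphic to $p(1)\cdots p(k)$. A signed permutation $w\in S^B_n$ globally avoids $p\in S_k$ if there are no indices $i_1<\cdots<i_k$ in $[\pm n]$ such that $w(i_1)\cdots w(i_k)$ is order-isomorphic to $p(1)\cdots p(k)$. A property defined for elements of all $S_n$ and of all $S^B_n$ is called persistent if there is a set $P$ of (unsigned) permutations such that, for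 all $n$, an element of $S_n$ has the property if and only if it avoids every $p\in P$, and an element of $S^B_n$ has the property if and only if it globally avoids every $p\in P$. Theorem. For every $n$, a signed permutation $w\in S^B_n$ is boolean if and only if it globally avoids both $321$ and $3412$. For every $n$, a permutation $w\in S_n$ is boolean if and only if it avoids both $321$ and $3412$. In particular, being boolean is a persistent property. -/

import Mathlib

/-! ### Bruhat order of a group with a distinguished set of generators -/

section Bruhat

variable {G : Type*} [Group G]

/-- The length of `g` with respect to the set of generators `S` (each of them an involution in the
case of a Coxeter group): the least number of letters in a word over `S` with product `g`. -/
noncomputable def genLength (S : Set G) (g : G) : ℕ :=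
  sInf {k : ℕ | ∃ l : List G, (∀ x ∈ l, x ∈ S) ∧ l.prod = g ∧ l.length = k}

/-- The reflections: all conjugates of the generators. -/
def reflections (S : Set G) : Set G :=
  {t | ∃ g : G, ∃ s ∈ S, t = g * s * g⁻¹}

/-- The elementary relation of the Bruhat order: `v = u * t` for a reflection `t`,
and `v` is longer than `u`. -/
def BruhatStep (S : Set G) (u v : G) : Prop :=
  ∃ t ∈ reflections S, v = u * t ∧ genLength S u < genLength S v

/-- The Bruhat order of `(G, S)`: the reflexive transitive closure of `BruhatStep`. -/
def BruhatLE (S : Set G) : G → G → Prop :=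
  Relation.ReflTransGen (BruhatStep S)

/-- `w` is boolean: its principal order ideal in the Bruhat order is isomorphic, as a partially
ordered set, to the lattice of all subsets of a finite set. -/
def IsBooleanElement (S : Set G) (w : G) : Prop :=
  ∃ (k : ℕ) (e : {v : G // BruhatLE S v w} ≃ Finset (Fin k)),
    ∀ a b : {v : G // BruhatLE S v w}, BruhatLE S a.1 b.1 ↔ e a ⊆ e b

end Bruhat

/-! ### The symmetric group -/

/-- The adjacent transpositions, the Coxeter generators of the symmetric group. -/
def simpleA (n : ℕ) : Set (Equiv.Perm (Fin n)) :=
  {s | ∃ i j : Fin n, (i : ℕ) + 1 = j ∧ s = Equiv.swap i j}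

/-! ### Signed permutations -/

/-- The set `{±1, …, ±n}`, ordered as a set of integers. -/
abbrev SignedIndex (n : ℕ) : Type := {x : ℤ // x ≠ 0 ∧ |x| ≤ (n : ℤ)}

instance (n : ℕ) : Neg (SignedIndex n) :=
  ⟨fun x => ⟨-x.1, neg_ne_zero.2 x.2.1, by rw [abs_neg]; exact x.2.2⟩⟩

theorem SignedIndex.val_neg {n : ℕ} (x : SignedIndex n) : (-x).1 = -x.1 := rfl

/-- The group of signed permutations of size `n`: the bijections `w` of `{±1, …, ±n}`
with `w (-x) = - w x`. -/
def signedPermGroup (n : ℕ) : Subgroup (Equiv.Perm (SignedIndex n)) where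
  carrier := {w | ∀ x, w (-x) = -w x}
  one_mem' := fun _ => rfl
  mul_mem' := by
    intro a b ha hb x
    rw [Equiv.Perm.mul_apply, Equiv.Perm.mul_apply, hb, ha]
  inv_mem' := by
    intro a ha x
    have h := ha (a⁻¹ x)
    rw [← Equiv.Perm.mul_apply a a⁻¹ x, mul_inv_cancel, Equiv.Perm.one_apply] at h
    rw [Equiv.Perm.inv_eq_iff_eq, h]

/-- A signed permutation of size `n`. -/
abbrev SignedPerm (n : ℕ) : Type := signedPermGroup n

/-- The element `i + 1` of `{±1, …, ±n}`, for `0 ≤ i < n`. -/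
def posIndex {n : ℕ} (i : ℕ) (h : i < n) : SignedIndex n :=
  ⟨(i : ℤ) + 1, by omega, by rw [abs_of_nonneg (by omega)]; omega⟩

/-- The Coxeter generator `s₀`, exchanging `1` and `-1` (window notation `(-1) 2 … n`). -/
def simpleZero {n : ℕ} (h : 0 < n) : SignedPerm n :=
  ⟨Equiv.swap (posIndex 0 h) (-posIndex 0 h), by
    intro x
    have hx := x.2.1
    simp only [Equiv.swap_apply_def, Subtype.ext_iff, SignedIndex.val_neg, posIndex]
    split_ifs <;> simp only [SignedIndex.val_neg] <;> omega⟩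

/-- The Coxeter generator exchanging `i + 1` with `i + 2` and `-(i + 1)` with `-(i + 2)`. -/
def simpleSucc {n : ℕ} (i : ℕ) (h : i + 1 < n) : SignedPerm n :=
  ⟨Equiv.swap (posIndex i (Nat.lt_of_succ_lt h)) (posIndex (i + 1) h) *
      Equiv.swap (-posIndex i (Nat.lt_of_succ_lt h)) (-posIndex (i + 1) h), by
    intro x
    have hx := x.2.1
    simp only [Equiv.Perm.mul_apply, Equiv.swap_apply_def, apply_ite Subtype.val, Subtype.ext_iff,
      SignedIndex.val_neg, posIndex]
    split_ifs <;> omega⟩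

/-- The Coxeter generators `s₀, s₁, …, s₍ₙ₋₁₎` of the group of signed permutations. -/
def simpleB (n : ℕ) : Set (SignedPerm n) :=
  {s | (∃ h : 0 < n, s = simpleZero h) ∨ ∃ (i : ℕ) (h : i + 1 < n), s = simpleSucc i h}

/-! ### Patterns -/

/-- `w` contains the pattern `p`: there are positions `i₁ < ⋯ < iₖ` such that the word
`w i₁, …, w iₖ` is order-isomorphic to `p 1, …, p k`. -/
def HasPattern {α : Type*} [LinearOrder α] {k : ℕ} (p : Equiv.Perm (Fin k))
    (w : Equiv.Perm α) : Prop :=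
  ∃ i : Fin k → α, StrictMono i ∧ ∀ a b : Fin k, w (i a) < w (i b) ↔ p a < p b

/-- The permutation `w` avoids the pattern `p`. -/
def Avoids {n k : ℕ} (p : Equiv.Perm (Fin k)) (w : Equiv.Perm (Fin n)) : Prop :=
  ¬ HasPattern p w

/-- The signed permutation `w` globally avoids the pattern `p`: the positions of an occurrence
range over all of `{±1, …, ±n}`. -/
def GloballyAvoids {n k : ℕ} (p : Equiv.Perm (Fin k)) (w : SignedPerm n) : Prop :=
  ¬ HasPattern p (w : Equiv.Perm (SignedIndex n))

/-- The permutation with one-line notation `321`. -/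
def perm321 : Equiv.Perm (Fin 3) :=
  ⟨![2, 1, 0], ![2, 1, 0], by decide, by decide⟩

/-- The permutation with one-line notation `3412`. -/
def perm3412 : Equiv.Perm (Fin 4) :=
  ⟨![2, 3, 0, 1], ![2, 3, 0, 1], by decide, by decide⟩

/-- A property of permutations and of signed permutations is persistent if one set `P` of (unsigned)
patterns describes it both by avoidance in all symmetric groups and by global avoidance in all
groups of signed permutations. -/
def IsPersistent (propA : ∀ n : ℕ, Equiv.Perm (Fin n) → Prop)
    (propB : ∀ n : ℕ, SignedPerm n → Prop) : Prop :=
  ∃ P : Set (Σ k : ℕ, Equiv.Perm (Fin k)),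
    (∀ (n : ℕ) (w : Equiv.Perm (Fin n)), propA n w ↔ ∀ p ∈ P, Avoids p.2 w) ∧
    (∀ (n : ℕ) (w : SignedPerm n), propB n w ↔ ∀ p ∈ P, GloballyAvoids p.2 w)

/-! ### Groups with an inversion cocycle -/

section InversionSystem

variable {G : Type*} [Group G]

/-! An element is boolean exactly when it is the product of a word in distinct generators, and these
products are exactly the elements that avoid both patterns. The two types are treated at once: what
matters is that the generators exchange neighbours of a finite linear order, up to a symmetry `σ`
(the identity in type A, negation in type B).

For the first equivalence, the subgroups `cut s` read off the letters of a word without repetition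
from its product. Hence the ideal below such a product is the lattice of subsets of its letters
(`isBooleanElement_of_nodup`). Conversely, if the ideal of `w` is boolean of rank `k`, a reduced
word of `w` has at most `k` letters, while all `k` atoms occur among them
(`nodup_of_isBooleanElement`). Strong exchange, which turns Bruhat relations into subwords, comes
from an inversion cocycle.

For the second, if `w` avoids both patterns and has a descent at `s`, then `w * s` preserves the
cuts at `s` (`mul_mem_cut`), so `s` splits off as a letter used only once. Appending `s` to an
element that preserves its cuts neither creates nor destroys a pattern (`avoidsBoth_mul_iff`). -/

/-- Data on a group with generators `S` which express that `(G, S)` is a Coxeter system: `inv g t`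
says that the reflection `t` is an inversion of `g`, and `cut s` is a subgroup containing all
the generators but `s`. -/
structure InversionSystem (S : Set G) where
  /-- The reflection `t` is an inversion of `g`. -/
  inv : G → G → Prop
  /-- A subgroup containing all the generators but `s`. -/
  cut : G → Subgroup G
  mul_self : ∀ s ∈ S, s * s = 1
  inv_simple : ∀ s ∈ S, ∀ t ∈ reflections S, inv s t ↔ t = s
  -- The cocycle rule: the inversions of `g * h` are the symmetric difference of those of `h` and
  -- the conjugates by `h⁻¹` of those of `g`.
  inv_mul : ∀ g h, ∀ t ∈ reflections S, inv (g * h) t ↔ ¬ (inv h t ↔ inv g (h * t * h⁻¹))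
  cut_simple : ∀ s ∈ S, ∀ s' ∈ S, s' ∈ cut s ↔ s' ≠ s
  descent : ∀ g, g ≠ 1 → ∃ s ∈ S, inv g s

theorem mem_reflections_of_mem {S : Set G} {s : G} (hs : s ∈ S) : s ∈ reflections S :=
  ⟨1, s, hs, by simp⟩

theorem conj_mem_reflections {S : Set G} {t : G} (ht : t ∈ reflections S) (h : G) :
    h * t * h⁻¹ ∈ reflections S := by
  obtain ⟨g, s, hs, rfl⟩ := ht
  exact ⟨h * g, s, hs, by group⟩

theorem genLength_le {S : Set G} {l : List G} (hl : ∀ x ∈ l, x ∈ S) :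
    genLength S l.prod ≤ l.length :=
  Nat.sInf_le ⟨l, hl, rfl, rfl⟩

theorem List.Nodup.eq_filter_of_sublist {β : Type*} [DecidableEq β] {l l' : List β}
    (hl : l.Nodup) (h : l'.Sublist l) : l' = l.filter (· ∈ l') := by
  induction h with
  | slnil => rfl
  | @cons l₁ l₂ a h ih =>
    rw [List.nodup_cons] at hl
    rw [List.filter_cons_of_neg (by simpa using fun h1 => hl.1 (h.subset h1))]
    exact ih hl.2
  | @cons_cons l₁ l₂ a h ih =>
    rw [List.nodup_cons] at hl
    rw [List.filter_cons_of_pos (by simp)]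
    congr 1
    refine (ih hl.2).trans (List.filter_congr fun x hx => ?_)
    have : x ≠ a := fun e => hl.1 (e ▸ hx)
    simp [this]

namespace InversionSystem

variable {S : Set G} (I : InversionSystem S)
include I

/-! ### Strong exchange and reduced words -/

theorem inv_one {t : G} (ht : t ∈ reflections S) : ¬ I.inv 1 t := by
  have := I.inv_mul 1 1 t ht
  simp at this
  exact this

/-- For `t = g * s * g⁻¹` the cocycle rule gives one contribution from `g⁻¹`, one from `s` and one
from `g`; the first and the last agree, since `g⁻¹ * g = 1` has no inversions, and cancel. -/
theorem inv_self {t : G} (ht : t ∈ reflections S) : I.inv t t := by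
  obtain ⟨g, s, hs, rfl⟩ := id ht
  have hs' := mem_reflections_of_mem hs
  have h1 := I.inv_mul (g * s) g⁻¹ _ ht
  have h2 := I.inv_mul g s s hs'
  have h3 := I.inv_mul g⁻¹ g s hs'
  have h4 := I.inv_one hs'
  have h5 := I.inv_simple s hs s hs'
  have e : g⁻¹ * (g * s * g⁻¹) * g⁻¹⁻¹ = s := by group
  rw [e] at h1
  rw [mul_inv_cancel_right] at h2
  rw [inv_mul_cancel] at h3
  tauto

/-- The strong exchange property. -/
theorem exchange {l : List G} (hl : ∀ x ∈ l, x ∈ S) {t : G} (ht : t ∈ reflections S)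
    (h : I.inv l.prod t) :
    ∃ l' : List G, l'.Sublist l ∧ l'.length + 1 = l.length ∧ l.prod * t = l'.prod := by
  induction l with
  | nil => exact absurd h (I.inv_one ht)
  | cons s l ih =>
    have hs := hl s (by simp)
    have hl := fun x hx => hl x (List.mem_cons_of_mem s hx)
    rw [List.prod_cons, I.inv_mul _ _ _ ht, I.inv_simple s hs _ (conj_mem_reflections ht _)] at h
    by_cases h1 : I.inv l.prod t
    · obtain ⟨l', h2, h3, h4⟩ := ih hl h1
      exact ⟨s :: l', h2.cons_cons s, by simp [h3], by simp [← h4, mul_assoc]⟩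
    -- The inversion comes from the first letter, and that letter is the one to delete.
    · have h2 : l.prod * t * l.prod⁻¹ = s := by tauto
      refine ⟨l, List.sublist_cons_self s l, rfl, ?_⟩
      rw [List.prod_cons, mul_assoc, mul_inv_eq_iff_eq_mul.1 h2, ← mul_assoc, I.mul_self s hs,
        one_mul]

/-- Induction on the number of inversions: for a descent `s` of `w`, conjugation by `s` injects the
inversions of `w * s` into those of `w` and misses `s`. -/
theorem exists_word [Finite G] (w : G) : ∃ l : List G, (∀ x ∈ l, x ∈ S) ∧ l.prod = w := by
  induction h : {t ∈ reflections S | I.inv w t}.ncard using Nat.strong_induction_on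
    generalizing w with
  | _ n ih =>
  by_cases hw : w = 1
  · exact ⟨[], by simp, by simp [hw]⟩
  obtain ⟨s, hs, hws⟩ := I.descent w hw
  have hs' := mem_reflections_of_mem hs
  have hss := I.mul_self s hs
  have hinv : s⁻¹ = s := inv_eq_of_mul_eq_one_left hss
  have hlt : {t ∈ reflections S | I.inv (w * s) t}.ncard < n := by
    rw [← h]
    have hinj : Function.Injective fun t => s * t * s⁻¹ := (MulAut.conj s).injective
    rw [← Set.ncard_image_of_injective _ hinj]
    refine Set.ncard_lt_ncard ⟨?_, fun hsub => ?_⟩ (Set.toFinite _)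
    · rintro _ ⟨t, ⟨ht, h1⟩, rfl⟩
      refine ⟨conj_mem_reflections ht s, ?_⟩
      rw [I.inv_mul _ _ _ ht, I.inv_simple s hs t ht] at h1
      by_cases h2 : t = s
      · subst h2
        simpa using hws
      · tauto
    · obtain ⟨t, ⟨ht, h1⟩, h2⟩ := hsub ⟨hs', hws⟩
      have h3 : t = s := hinj (by simpa using h2)
      subst h3
      rw [I.inv_mul _ _ _ ht, I.inv_simple t hs t ht, mul_inv_cancel_right] at h1
      tauto
  obtain ⟨l, hl, h1⟩ := ih _ hlt (w * s) rfl
  refine ⟨l ++ [s], ?_, by simp [h1, mul_assoc, hss]⟩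
  simp only [List.mem_append, List.mem_singleton]
  rintro x (hx | rfl)
  exacts [hl x hx, hs]

/-- The infimum in `genLength` would be the default value 0 on an empty set; a word exists, so it is
attained. -/
theorem exists_reduced [Finite G] (w : G) :
    ∃ l : List G, (∀ x ∈ l, x ∈ S) ∧ l.prod = w ∧ l.length = genLength S w := by
  obtain ⟨l, hl, h⟩ := I.exists_word w
  exact Nat.sInf_mem (s := {k : ℕ | ∃ l : List G, (∀ x ∈ l, x ∈ S) ∧ l.prod = w ∧ l.length = k})
    ⟨_, l, hl, h, rfl⟩

theorem genLength_mul_lt [Finite G] {w t : G} (ht : t ∈ reflections S) (h : I.inv w t) :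
    genLength S (w * t) < genLength S w := by
  obtain ⟨l, hl, rfl, h2⟩ := I.exists_reduced w
  obtain ⟨l', h3, h4, h5⟩ := I.exchange hl ht h
  rw [h5, ← h2, ← h4, Nat.lt_succ_iff]
  exact genLength_le fun x hx => hl x (h3.subset hx)

theorem mul_self_of_mem_reflections {t : G} (ht : t ∈ reflections S) : t * t = 1 := by
  obtain ⟨g, s, hs, rfl⟩ := ht
  have : g * s * g⁻¹ * (g * s * g⁻¹) = g * (s * s) * g⁻¹ := by group
  rw [this, I.mul_self s hs]
  group

theorem inv_of_genLength_lt [Finite G] {u t : G} (ht : t ∈ reflections S)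
    (h : genLength S u < genLength S (u * t)) : I.inv (u * t) t := by
  by_contra h1
  rw [I.inv_mul _ _ _ ht, mul_inv_cancel_right] at h1
  have h2 := I.inv_self ht
  have h3 := I.genLength_mul_lt (w := u) ht (by tauto)
  omega

/-- One half of the subword property of the Bruhat order. -/
theorem exists_sublist_of_bruhatLE [Finite G] {u v : G} (h : BruhatLE S u v) :
    ∀ l : List G, (∀ x ∈ l, x ∈ S) → l.prod = v → ∃ l' : List G, l'.Sublist l ∧ l'.prod = u := by
  induction h with
  | refl => exact fun l _ h => ⟨l, List.Sublist.refl l, h⟩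
  | @tail b c _ h ih =>
    rintro l hl rfl
    obtain ⟨t, ht, h1, h2⟩ := h
    have h3 : I.inv l.prod t := by
      rw [h1] at h2 ⊢
      exact I.inv_of_genLength_lt ht h2
    obtain ⟨l', h4, _, h5⟩ := I.exchange hl ht h3
    rw [h1, mul_assoc, I.mul_self_of_mem_reflections ht, mul_one] at h5
    obtain ⟨l'', h6, h7⟩ := ih l' (fun x hx => hl x (h4.subset hx)) h5.symm
    exact ⟨l'', h6.trans h4, h7⟩

/-! ### Words without repeated letters -/

theorem prod_mem_cut {l : List G} (hl : ∀ x ∈ l, x ∈ S) {s : G} (hs : s ∈ S) (h : s ∉ l) :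
    l.prod ∈ I.cut s :=
  Subgroup.list_prod_mem _ fun x hx =>
    (I.cut_simple s hs x (hl x hx)).2 fun e => h (e ▸ hx)

/-- Around the only occurrence of `s`, all other letters lie in `cut s` and `s` does not. The
product thus determines the set of letters. -/
theorem mem_iff_of_nodup {l : List G} (hl : ∀ x ∈ l, x ∈ S) (hd : l.Nodup) {s : G} (hs : s ∈ S) :
    s ∈ l ↔ l.prod ∉ I.cut s := by
  refine ⟨fun h => ?_, fun h => by_contra fun h1 => h (I.prod_mem_cut hl hs h1)⟩
  obtain ⟨a, b, rfl⟩ := List.append_of_mem h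
  have hd' := (List.nodup_middle.1 hd)
  rw [List.nodup_cons, List.mem_append, not_or] at hd'
  have ha := I.prod_mem_cut (fun x hx => hl x (by simp [hx])) hs hd'.1.1
  have hb := I.prod_mem_cut (fun x hx => hl x (by simp [hx])) hs hd'.1.2
  rw [List.prod_append, List.prod_cons, Subgroup.mul_mem_cancel_left _ ha,
    Subgroup.mul_mem_cancel_right _ hb, I.cut_simple s hs s hs]
  simp

/-- Any other word for the same product must use each of these letters, or the product would lie in
a cut subgroup. -/
theorem genLength_of_nodup [Finite G] {l : List G} (hl : ∀ x ∈ l, x ∈ S) (hd : l.Nodup) :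
    genLength S l.prod = l.length := by
  refine le_antisymm (genLength_le hl) ?_
  obtain ⟨m, hm, h1, h2⟩ := I.exists_reduced l.prod
  rw [← h2]
  refine (hd.subperm fun s hs => by_contra fun h => ?_).length_le
  exact (I.mem_iff_of_nodup hl hd (hl s hs)).1 hs (h1 ▸ I.prod_mem_cut hm (hl s hs) h)

/-- Deleting letters from a word without repeated letters goes down in the Bruhat order. -/
theorem bruhatLE_of_sublist [Finite G] {l l' : List G} (h : l'.Sublist l) :
    ∀ c : List G, (∀ x ∈ c ++ l, x ∈ S) → (c ++ l).Nodup →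
      BruhatLE S (c ++ l').prod (c ++ l).prod := by
  induction h with
  | slnil => exact fun c _ _ => Relation.ReflTransGen.refl
  | @cons l₁ l₂ a h ih =>
    intro c hc hd
    have hsub : (c ++ l₂).Sublist (c ++ a :: l₂) :=
      (List.Sublist.refl c).append (List.sublist_cons_self a l₂)
    have hc' : ∀ x ∈ c ++ l₂, x ∈ S := fun x hx => hc x (hsub.subset hx)
    -- Inserting `a` in front of `l₂` is right multiplication by the conjugate of `a` by
    -- `l₂.prod⁻¹`, and it adds exactly one to the length.
    refine Relation.ReflTransGen.tail (ih c hc' (hd.sublist hsub))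
      ⟨l₂.prod⁻¹ * a * l₂.prod⁻¹⁻¹, ⟨_, a, hc a (by simp), rfl⟩, ?_, ?_⟩
    · simp only [List.prod_append, List.prod_cons]
      group
    · rw [I.genLength_of_nodup hc' (hd.sublist hsub), I.genLength_of_nodup hc hd]
      simp
  | @cons_cons l₁ l₂ a h ih =>
    intro c hc hd
    have := ih (c ++ [a]) (by simpa using hc) (by simpa using hd)
    simpa using this

/-- Each element of the ideal is the product of a subword, whose letters are recovered by the cut
subgroups; the Bruhat order becomes inclusion of letter sets. -/
theorem isBooleanElement_of_nodup [Finite G] {l : List G} (hl : ∀ x ∈ l, x ∈ S) (hd : l.Nodup) :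
    IsBooleanElement S l.prod := by
  classical
  have key : ∀ a : {v : G // BruhatLE S v l.prod}, ∃ A : List G, A.Sublist l ∧ A.prod = a.1 :=
    fun a => I.exists_sublist_of_bruhatLE a.2 l hl rfl
  choose A hA hA' using key
  have hAS : ∀ a, ∀ x ∈ A a, x ∈ S := fun a x hx => hl x ((hA a).subset hx)
  have hmem : ∀ a, ∀ x ∈ l, x ∈ A a ↔ a.1 ∉ I.cut x := fun a x hx => by
    rw [I.mem_iff_of_nodup (hAS a) (hd.sublist (hA a)) (hl x hx), hA' a]
  have hle : ∀ a b : {v : G // BruhatLE S v l.prod}, BruhatLE S a.1 b.1 ↔ A a ⊆ A b := by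
    intro a b
    constructor
    · intro h x hx
      obtain ⟨m, hm, hm'⟩ := I.exists_sublist_of_bruhatLE h (A b) (hAS b) (hA' b)
      have hxl := (hA a).subset hx
      rw [hmem a x hxl, ← hm', ← I.mem_iff_of_nodup (fun y hy => hAS b y (hm.subset hy))
        (hd.sublist (hm.trans (hA b))) (hl x hxl)] at hx
      exact hm.subset hx
    · intro h
      have hs : (A a).Sublist (A b) := by
        rw [hd.eq_filter_of_sublist (hA a), hd.eq_filter_of_sublist (hA b)]
        exact List.monotone_filter_right l fun x hx => by simpa using h (by simpa using hx)
      have := I.bruhatLE_of_sublist hs [] (hAS b) (hd.sublist (hA b))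
      simpa [hA'] using this
  let f : {v : G // BruhatLE S v l.prod} → Finset (Fin l.length) :=
    fun a => Finset.univ.filter fun i => l.get i ∈ A a
  have hf : ∀ a b, f a ⊆ f b ↔ A a ⊆ A b := by
    intro a b
    constructor
    · intro h x hx
      obtain ⟨i, rfl⟩ := List.get_of_mem ((hA a).subset hx)
      have := h (show i ∈ f a by simpa [f] using hx)
      simpa [f] using this
    · intro h i hi
      simp only [f, Finset.mem_filter, Finset.mem_univ, true_and] at hi ⊢
      exact h hi
  have hbij : Function.Bijective f := by
    constructor
    · intro a b hab
      have h1 := (hf a b).1 hab.le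
      have h2 := (hf b a).1 hab.ge
      apply Subtype.ext
      rw [← hA' a, ← hA' b, hd.eq_filter_of_sublist (hA a), hd.eq_filter_of_sublist (hA b)]
      congr 1
      exact List.filter_congr fun x _ => by simpa using ⟨@h1 x, @h2 x⟩
    · intro B
      let m := l.filter fun x => ∃ i ∈ B, l.get i = x
      have hm : m.Sublist l := List.filter_sublist
      have hmS : ∀ x ∈ m, x ∈ S := fun x hx => hl x (hm.subset hx)
      have hml : BruhatLE S m.prod l.prod := by
        simpa using I.bruhatLE_of_sublist hm [] hl hd
      refine ⟨⟨m.prod, hml⟩, ?_⟩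
      ext i
      simp only [f, Finset.mem_filter, Finset.mem_univ, true_and]
      rw [hmem _ _ (List.get_mem l i), ← I.mem_iff_of_nodup hmS (hd.sublist hm)
        (hl _ (List.get_mem l i))]
      simp only [m, List.mem_filter, List.get_mem, true_and, decide_eq_true_eq]
      constructor
      · rintro ⟨j, hj, hij⟩
        rwa [← hd.injective_get hij]
      · exact fun hi => ⟨i, hi, rfl⟩
  exact ⟨l.length, Equiv.ofBijective f hbij, fun a b => (hle a b).trans (hf a b).symm⟩

/-! ### Words of boolean elements -/

/-- A prefix of a reduced word is below it in the Bruhat order. -/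
theorem bruhatLE_append [Finite G] (a b : List G) (h : ∀ x ∈ a ++ b, x ∈ S)
    (hr : genLength S (a ++ b).prod = (a ++ b).length) :
    BruhatLE S a.prod (a ++ b).prod ∧ genLength S a.prod = a.length := by
  induction b using List.reverseRecOn with
  | nil => simp at hr ⊢; exact ⟨Relation.ReflTransGen.refl, hr⟩
  | append_singleton b s ih =>
    rw [← List.append_assoc] at h hr ⊢
    have hs := h s (by simp)
    have h' : ∀ x ∈ a ++ b, x ∈ S := fun x hx => h x (List.mem_append_left _ hx)
    obtain ⟨l, hl, h1, h2⟩ := I.exists_reduced (a ++ b).prod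
    have h3 : genLength S ((a ++ b) ++ [s]).prod ≤ l.length + 1 := by
      have := genLength_le (S := S) (l := l ++ [s]) (by
        simp only [List.mem_append, List.mem_singleton]
        rintro x (hx | rfl)
        exacts [hl x hx, hs])
      rwa [List.prod_append, h1, ← List.prod_append, List.length_append] at this
    have h4 := genLength_le h'
    have h5 : genLength S (a ++ b).prod = (a ++ b).length := by
      rw [hr, List.length_append (bs := [s]), List.length_singleton] at h3
      omega
    refine ⟨(ih h' h5).1.tail ⟨s, mem_reflections_of_mem hs, by simp [mul_assoc], ?_⟩, (ih h' h5).2⟩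
    rw [h5, hr, List.length_append (bs := [s]), List.length_singleton]
    omega

theorem ne_one {s : G} (hs : s ∈ S) : s ≠ 1 := by
  rintro rfl
  exact (I.cut_simple 1 hs 1 hs).1 (one_mem _) rfl

theorem one_bruhatLE [Finite G] (w : G) : BruhatLE S 1 w := by
  obtain ⟨l, hl, rfl, h⟩ := I.exists_reduced w
  simpa using (I.bruhatLE_append [] l hl h.symm).1

theorem exists_simple_bruhatLE [Finite G] {w : G} (hw : w ≠ 1) : ∃ s ∈ S, BruhatLE S s w := by
  obtain ⟨l, hl, rfl, h⟩ := I.exists_reduced w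
  cases l with
  | nil => simp at hw
  | cons s l => exact ⟨s, hl s (by simp), by simpa using (I.bruhatLE_append [s] l hl h.symm).1⟩

theorem exists_lower [Finite G] {w : G} (hw : w ≠ 1) :
    ∃ u, BruhatLE S u w ∧ genLength S u + 1 = genLength S w := by
  obtain ⟨l, hl, rfl, h⟩ := I.exists_reduced w
  obtain rfl | ⟨l, s, rfl⟩ := l.eq_nil_or_concat
  · simp at hw
  · obtain ⟨h1, h2⟩ := I.bruhatLE_append l [s] (by simpa using hl) (by simpa using h.symm)
    exact ⟨l.prod, by simpa using h1, by rw [h2, ← h]; simp⟩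

/-- A double count: length ≤ rank ≤ number of distinct letters in a reduced word. Equality
throughout rules out repetitions. -/
theorem nodup_of_isBooleanElement [Finite G] {w : G} (h : IsBooleanElement S w) :
    ∃ l : List G, (∀ x ∈ l, x ∈ S) ∧ l.Nodup ∧ l.prod = w := by
  classical
  obtain ⟨k, e, he⟩ := h
  -- Going down one unit of length at a time gives a strict chain of subsets.
  have hlen : ∀ (n : ℕ) (v : {v : G // BruhatLE S v w}), genLength S v.1 = n → n ≤ (e v).card := by
    intro n
    induction n with
    | zero => simp
    | succ n ih =>
      intro v hv
      have hv1 : v.1 ≠ 1 := by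
        intro h1
        have := genLength_le (S := S) (l := []) (by simp)
        rw [h1] at hv
        simp at this
        omega
      obtain ⟨u, hu, hul⟩ := I.exists_lower hv1
      let u' : {v : G // BruhatLE S v w} := ⟨u, hu.trans v.2⟩
      have h1 := ih u' (show genLength S u = n by omega)
      have h2 : e u' ⊂ e v := by
        refine ((he u' v).1 hu).ssubset_of_ne fun h3 => ?_
        rw [← e.injective h3] at hul
        exact absurd hul (Nat.succ_ne_self _)
      have := Finset.card_lt_card h2
      omega
  obtain ⟨l, hl, rfl, hr⟩ := I.exists_reduced w
  have hk : l.length ≤ k := by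
    refine (hlen _ ⟨l.prod, Relation.ReflTransGen.refl⟩ hr.symm).trans ?_
    simpa using Finset.card_le_univ (e ⟨l.prod, Relation.ReflTransGen.refl⟩)
  have hone : e ⟨1, I.one_bruhatLE _⟩ = ∅ := by
    have := (he ⟨1, I.one_bruhatLE _⟩ (e.symm ∅)).1 (I.one_bruhatLE _)
    simpa using this
  -- An atom has a generator below it, hence is that generator; a generator below `l.prod` is a
  -- letter of `l`, as otherwise it would lie in its own cut subgroup.
  have hatom : ∀ i : Fin k, (e.symm {i}).1 ∈ l.toFinset := by
    intro i
    have h1 : (e.symm {i}).1 ≠ 1 := by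
      intro h1
      have : e.symm {i} = ⟨1, I.one_bruhatLE _⟩ := Subtype.ext h1
      rw [← this] at hone
      simp at hone
    obtain ⟨s, hs, hle⟩ := I.exists_simple_bruhatLE h1
    have hsw : BruhatLE S s l.prod := hle.trans (e.symm {i}).2
    have h2 : e ⟨s, hsw⟩ = {i} := by
      have := (he ⟨s, hsw⟩ (e.symm {i})).1 hle
      rw [Equiv.apply_symm_apply, Finset.subset_singleton_iff] at this
      refine this.resolve_left fun h3 => I.ne_one hs ?_
      rw [← hone] at h3
      exact congrArg Subtype.val (e.injective h3)
    rw [← h2, Equiv.symm_apply_apply, List.mem_toFinset]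
    by_contra h4
    obtain ⟨l', h5, h6⟩ := I.exists_sublist_of_bruhatLE hsw l hl rfl
    have h7 := I.prod_mem_cut (l := l') (fun x hx => hl x (h5.subset hx)) hs
      fun hx => h4 (h5.subset hx)
    rw [h6] at h7
    exact (I.cut_simple s hs s hs).1 h7 rfl
  have hcard : k ≤ l.toFinset.card := by
    have := Finset.card_le_card_of_injOn (s := (Finset.univ : Finset (Fin k))) (t := l.toFinset)
      (fun i => (e.symm {i}).1) (fun i _ => hatom i) fun i _ j _ hij => by
        simpa using e.symm.injective (Subtype.ext hij)
    simpa using this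
  have := List.toFinset_card_le l
  exact ⟨l, hl, List.dedup_eq_self.1 (List.Sublist.eq_of_length_le (List.dedup_sublist l)
    (by rw [← List.card_toFinset]; omega)), rfl⟩

end InversionSystem

end InversionSystem

/-! ### Groups acting on a finite linear order, generated by exchanges of neighbours -/

section AdjacentGenerators

variable {G α : Type*} [Group G] [LinearOrder α] [MulAction G α]

/-- The generators `S` of a group of permutations of `α` are exchanges of neighbours. The map `σ`
commutes with the group, and preserves or reverses the order; a generator exchanges two neighbours
and their images under `σ`. -/
structure AdjacentGenerators (S : Set G) (σ : α → α) : Prop where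
  mul_self : ∀ s ∈ S, s * s = 1
  ne_one : ∀ s ∈ S, s ≠ 1
  covBy : ∀ s ∈ S, ∀ x : α, s • x ≠ x → x ⋖ s • x ∨ s • x ⋖ x
  exists_smul_eq : ∀ p q : α, p ⋖ q → ∃ s ∈ S, s • p = q
  moved : ∀ s ∈ S, ∀ x y : α, s • x ≠ x → s • y ≠ y →
    y = x ∨ y = s • x ∨ y = σ x ∨ y = σ (s • x)
  comm : ∀ (g : G) (x : α), σ (g • x) = g • σ x
  order : ∀ a b c d : α, a ≠ b → c ≠ d → ((a < b ↔ c < d) ↔ (σ a < σ b ↔ σ c < σ d))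

/-- The elements of `G` which preserve the lower part of every cut of `α` that lies between two
neighbours exchanged by `s`. -/
def cutSubgroup (α : Type*) [LinearOrder α] [MulAction G α] (s : G) : Subgroup G where
  carrier := {g | ∀ p : α, p ⋖ s • p → ∀ x, g • x ≤ p ↔ x ≤ p}
  one_mem' := fun p _ x => by rw [one_smul]
  mul_mem' := fun {a b} ha hb p hp x => by rw [mul_smul, ha p hp, hb p hp]
  inv_mem' := fun {a} ha p hp x => by rw [← ha p hp (a⁻¹ • x), smul_inv_smul]

namespace AdjacentGenerators

variable {S : Set G} {σ : α → α} (A : AdjacentGenerators S σ)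
include A

/-! ### Reflections, inversions and cuts -/

theorem smul_smul_self {s : G} (hs : s ∈ S) (x : α) : s • s • x = x := by
  rw [← mul_smul, A.mul_self s hs, one_smul]

theorem smul_smul_self_of_reflection {t : G} (ht : t ∈ reflections S) (x : α) :
    t • t • x = x := by
  obtain ⟨g, s, hs, rfl⟩ := ht
  simp only [mul_smul, inv_smul_smul, A.smul_smul_self hs, smul_inv_smul]

theorem exists_covBy [FaithfulSMul G α] {s : G} (hs : s ∈ S) : ∃ p : α, p ⋖ s • p := by
  by_contra! h
  refine A.ne_one s hs (FaithfulSMul.eq_of_smul_eq_smul (α := α) fun x => ?_)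
  rw [one_smul]
  by_contra hx
  rcases A.covBy s hs x hx with h1 | h1
  · exact h x h1
  · exact h (s • x) (by rwa [A.smul_smul_self hs])

/-- Each point moves by at most one place, so only an exchanged pair can change its order. -/
theorem smul_lt_smul {s : G} (hs : s ∈ S) {x y : α} (hxy : x < y) (hne : y ≠ s • x) :
    s • x < s • y := by
  have inj : s • x ≠ s • y := fun h => hxy.ne (MulAction.injective s h)
  have hne' : s • y ≠ x := fun h => hne (by rw [← h, A.smul_smul_self hs])
  by_cases hx : s • x = x <;> by_cases hy : s • y = y
  · rwa [hx, hy]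
  · rw [hx] at inj ⊢
    refine lt_of_le_of_ne (not_lt.1 fun h => ?_) inj
    rcases A.covBy s hs y hy with h1 | h1
    · exact (h.trans hxy).not_gt h1.lt
    · exact h1.2 h hxy
  · rw [hy] at inj ⊢
    refine lt_of_le_of_ne (not_lt.1 fun h => ?_) inj
    rcases A.covBy s hs x hx with h1 | h1
    · exact h1.2 hxy h
    · exact (h.trans h1.lt).not_gt hxy
  · have h1 : s • x < y := by
      rcases A.covBy s hs x hx with h1 | h1
      · exact lt_of_le_of_ne (not_lt.1 fun h => h1.2 hxy h) hne.symm
      · exact h1.lt.trans hxy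
    refine lt_of_le_of_ne (not_lt.1 fun h => ?_) inj
    rcases A.covBy s hs y hy with h2 | h2
    · exact (h.trans h1).not_gt h2.lt
    · exact h2.2 h h1

theorem moved_of_reflection {t : G} (ht : t ∈ reflections S) (x y : α) (hx : t • x ≠ x)
    (hy : t • y ≠ y) : y = x ∨ y = t • x ∨ y = σ x ∨ y = σ (t • x) := by
  obtain ⟨g, s, hs, rfl⟩ := ht
  have key : ∀ z : α, (g * s * g⁻¹) • z ≠ z → s • g⁻¹ • z ≠ g⁻¹ • z := by
    intro z hz h
    exact hz (by rw [mul_smul, mul_smul, h, smul_inv_smul])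
  have := A.moved s hs _ _ (key x hx) (key y hy)
  simp only [inv_smul_eq_iff, ← A.comm, smul_inv_smul] at this
  simpa only [mul_smul, A.comm, smul_inv_smul] using this

/-- The points moved by `t` are among `x`, `t • x` and their images under `σ`, where `t` is
determined by `t • x`. -/
theorem reflection_ext [FaithfulSMul G α] {t t' : G} (ht : t ∈ reflections S)
    (ht' : t' ∈ reflections S) {x : α} (h : t • x = t' • x) (hx : t • x ≠ x) : t = t' := by
  have key : ∀ t ∈ reflections S, ∀ t' ∈ reflections S, t • x = t' • x → t • x ≠ x →
      ∀ y : α, t • y ≠ y → t • y = t' • y := by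
    intro t ht t' ht' h hx y hy
    rcases A.moved_of_reflection ht x y hx hy with rfl | rfl | rfl | rfl
    · exact h
    · rw [A.smul_smul_self_of_reflection ht, h, A.smul_smul_self_of_reflection ht']
    · rw [← A.comm, ← A.comm, h]
    · rw [← A.comm, ← A.comm, A.smul_smul_self_of_reflection ht, h,
        A.smul_smul_self_of_reflection ht']
  refine FaithfulSMul.eq_of_smul_eq_smul (α := α) fun y => ?_
  by_cases h1 : t • y = y
  · by_cases h2 : t' • y = y
    · rw [h1, h2]
    · exact (key t' ht' t ht h.symm (h ▸ hx) y h2).symm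
  · exact key t ht t' ht' h hx y h1

/-- Whether `g` reverses the pair `x, s • x` does not depend on the point `x` moved by `s`. -/
theorem reverses_congr {s : G} (hs : s ∈ S) (g : G) {x y : α} (hx : s • x ≠ x) (hy : s • y ≠ y) :
    (x < s • x ↔ g • x < g • s • x) ↔ (y < s • y ↔ g • y < g • s • y) := by
  have hgx : g • s • x ≠ g • x := fun h => hx (MulAction.injective g h)
  have hlt : ∀ a b : α, a ≠ b → (a < b ↔ ¬ b < a) := fun a b hab =>
    ⟨fun h => h.not_gt, fun h => lt_of_le_of_ne (not_lt.1 h) hab⟩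
  have h1 : (x < s • x ↔ g • x < g • s • x) ↔ (s • x < x ↔ g • s • x < g • x) := by
    rw [hlt _ _ hx, hlt _ _ hgx]
    tauto
  rcases A.moved s hs x y hx hy with rfl | rfl | rfl | rfl
  · rfl
  · rw [A.smul_smul_self hs]
    exact h1
  · simp only [← A.comm]
    exact A.order _ _ _ _ hx.symm hgx.symm
  · rw [h1, ← A.comm s, ← A.comm g, ← A.comm g, A.smul_smul_self hs]
    exact A.order _ _ _ _ hx hgx

/-- With `t = h * s * h⁻¹`, reversal by `g` is the exclusive or of the reversals by `g * h` and by
`h` of a pair exchanged by `s`; neither depends on the pair. -/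
theorem reverses_congr_of_reflection {t : G} (ht : t ∈ reflections S) (g : G) {x y : α}
    (hx : t • x ≠ x) (hy : t • y ≠ y) :
    (x < t • x ↔ g • x < g • t • x) ↔ (y < t • y ↔ g • y < g • t • y) := by
  obtain ⟨h, s, hs, rfl⟩ := ht
  obtain ⟨x, rfl⟩ := MulAction.surjective h x
  obtain ⟨y, rfl⟩ := MulAction.surjective h y
  simp only [mul_smul, inv_smul_smul] at hx hy ⊢
  have hx' : s • x ≠ x := fun e => hx (by rw [e])
  have hy' : s • y ≠ y := fun e => hy (by rw [e])
  have h1 := A.reverses_congr hs h hx' hy'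
  have h2 := A.reverses_congr hs (g * h) hx' hy'
  simp only [mul_smul] at h2
  have aux : ∀ a b c d e f : Prop, ((a ↔ b) ↔ (c ↔ d)) → ((a ↔ e) ↔ (c ↔ f)) →
      ((b ↔ e) ↔ (d ↔ f)) := by
    intro a b c d e f
    by_cases a <;> by_cases b <;> by_cases c <;> by_cases d <;> by_cases e <;> by_cases f <;>
      simp_all
  exact aux _ _ _ _ _ _ h1 h2

theorem exists_moved [FaithfulSMul G α] {t : G} (ht : t ∈ reflections S) : ∃ x : α, t • x ≠ x := by
  obtain ⟨g, s, hs, rfl⟩ := ht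
  obtain ⟨p, hp⟩ := A.exists_covBy hs
  refine ⟨g • p, fun h => hp.lt.ne' ?_⟩
  simp only [mul_smul, inv_smul_smul] at h
  exact MulAction.injective g h

theorem inverts_iff {t : G} (ht : t ∈ reflections S) (g : G) {x : α} (hx : t • x ≠ x) :
    (∃ y : α, y < t • y ∧ g • t • y < g • y) ↔ ¬ (x < t • x ↔ g • x < g • t • x) := by
  constructor
  · rintro ⟨y, h1, h2⟩
    rw [A.reverses_congr_of_reflection ht g hx h1.ne']
    exact fun h => (h.1 h1).not_gt h2
  · intro h
    rcases lt_or_gt_of_ne hx with h1 | h1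
    · refine ⟨t • x, ?_, ?_⟩ <;> rw [A.smul_smul_self_of_reflection ht]
      · exact h1
      · by_contra h2
        exact h (iff_of_false h1.not_gt h2)
    · refine ⟨x, h1, lt_of_le_of_ne (not_lt.1 fun h2 => h (iff_of_true h1 h2)) ?_⟩
      exact fun e => hx (MulAction.injective g e)

/-- To cross the cut above `p`, `s'` would have to exchange `p` with its successor `s • p`, and then
it would equal `s`. -/
theorem mem_cut_of_ne [FaithfulSMul G α] {s s' : G} (hs : s ∈ S) (hs' : s' ∈ S) (h : s' ≠ s) :
    s' ∈ cutSubgroup α s := by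
  intro p hp
  have key : ∀ x : α, x ≤ p → s' • x ≤ p := by
    intro x hx
    by_contra! h1
    rcases A.covBy s' hs' x (hx.trans_lt h1).ne' with h2 | h2
    · obtain rfl : x = p := hx.antisymm (not_lt.1 fun h3 => h2.2 h3 h1)
      exact h (A.reflection_ext (mem_reflections_of_mem hs') (mem_reflections_of_mem hs)
        (h2.unique_right hp) h2.lt.ne')
    · exact (hx.trans_lt h1).not_gt h2.lt
  exact fun x => ⟨fun hx => by simpa [A.smul_smul_self hs'] using key _ hx, key x⟩

theorem notMem_cut [FaithfulSMul G α] {s : G} (hs : s ∈ S) : s ∉ cutSubgroup α s := by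
  obtain ⟨p, hp⟩ := A.exists_covBy hs
  exact fun h => ((h p hp p).2 le_rfl).not_gt hp.lt

/-- Without a descent, `g` is increasing on neighbours, hence an automorphism of a finite linear
order, hence trivial. -/
theorem exists_descent [Finite α] [FaithfulSMul G α] {g : G} (hg : g ≠ 1) :
    ∃ s ∈ S, ∃ p : α, p ⋖ s • p ∧ g • s • p < g • p := by
  classical
  have := Fintype.ofFinite α
  let _ : LocallyFiniteOrder α := Fintype.toLocallyFiniteOrder
  by_contra! h
  have hm : StrictMono fun x : α => g • x := by
    rw [strictMono_iff_forall_covBy]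
    intro p q hpq
    obtain ⟨s, hs, rfl⟩ := A.exists_smul_eq p q hpq
    exact lt_of_le_of_ne (h s hs p hpq) fun e => hpq.lt.ne (MulAction.injective g e)
  refine hg (FaithfulSMul.eq_of_smul_eq_smul (α := α) fun x => ?_)
  have e : hm.orderIsoOfSurjective _ (MulAction.surjective g) = OrderIso.refl α :=
    Subsingleton.elim _ _
  simpa using congrArg (fun f : α ≃o α => f x) e

/-- The inversion cocycle of a group generated by exchanges of neighbours. -/
def inversionSystem [Finite α] [FaithfulSMul G α] : InversionSystem S where
  inv g t := ∃ x : α, x < t • x ∧ g • t • x < g • x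
  cut := cutSubgroup α
  mul_self := A.mul_self
  inv_simple s hs t ht := by
    constructor
    · rintro ⟨x, h1, h2⟩
      by_contra hne
      refine (A.smul_lt_smul hs h1 fun e => hne ?_).not_gt h2
      exact A.reflection_ext ht (mem_reflections_of_mem hs) e h1.ne'
    · rintro rfl
      obtain ⟨p, hp⟩ := A.exists_covBy hs
      exact ⟨p, hp.lt, by rw [A.smul_smul_self hs]; exact hp.lt⟩
  inv_mul g h t ht := by
    obtain ⟨x, hx⟩ := A.exists_moved ht
    have hx' : (h * t * h⁻¹) • h • x ≠ h • x := by
      simp only [mul_smul, inv_smul_smul]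
      exact fun e => hx (MulAction.injective h e)
    rw [A.inverts_iff ht _ hx, A.inverts_iff ht _ hx,
      A.inverts_iff (conj_mem_reflections ht h) _ hx']
    simp only [mul_smul, inv_smul_smul]
    tauto
  cut_simple s hs s' hs' := by
    refine ⟨?_, A.mem_cut_of_ne hs hs'⟩
    rintro h rfl
    exact A.notMem_cut hs h
  descent g hg := by
    obtain ⟨s, hs, p, hp, h⟩ := A.exists_descent hg
    exact ⟨s, hs, p, hp.lt, h⟩

end AdjacentGenerators

/-! ### The patterns 321 and 3412 -/

/-- The function `w` has no occurrence of `321` and no occurrence of `3412`. -/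
def AvoidsBoth (w : α → α) : Prop :=
  (∀ a b c, a < b → b < c → w c < w b → ¬ w b < w a) ∧
    ∀ a b c d, a < b → b < c → c < d → w c < w d → w d < w a → ¬ w a < w b

theorem avoidsBoth_one : AvoidsBoth fun x : α => (1 : G) • x := by
  simp only [AvoidsBoth, one_smul]
  exact ⟨fun a b c _ h _ h' => absurd h' (by order), fun a b c d h1 h2 h3 _ h4 => by order⟩

namespace AdjacentGenerators

variable {S : Set G} {σ : α → α} (A : AdjacentGenerators S σ)
include A

theorem smul_smul_lt {s : G} (hs : s ∈ S) {p x : α} (hp : p ⋖ s • p) (hx : x < p) : s • x < p := by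
  have h1 := A.smul_lt_smul hs hx (by
    rintro rfl
    rw [A.smul_smul_self hs] at hp
    exact hp.lt.not_gt hx)
  exact lt_of_le_of_ne (not_lt.1 fun h => hp.2 h h1) fun h =>
    (hx.trans hp.lt).ne (by rw [← h, A.smul_smul_self hs])

theorem lt_smul_smul {s : G} (hs : s ∈ S) {p x : α} (hp : p ⋖ s • p) (hx : s • p < x) :
    s • p < s • x := by
  have h1 := A.smul_lt_smul hs hx (by
    rw [A.smul_smul_self hs]
    exact (hp.lt.trans hx).ne')
  rw [A.smul_smul_self hs] at h1
  exact lt_of_le_of_ne (not_lt.1 fun h => hp.2 h1 h) fun h =>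
    (hp.lt.trans hx).ne (MulAction.injective s h)

/-- Let `p`, `s • p` be a descent. Avoiding 321 puts the values left of it below `w • p` and those
right of it above `w • s • p`; avoiding 3412 then puts every left value below every right one. So `w
* s` sends the part up to `p` below the rest, and by counting preserves it. -/
theorem mul_mem_cut [Finite α] {s w : G} (hs : s ∈ S) (hw : AvoidsBoth fun x : α => w • x) {p₀ : α}
    (hp₀ : p₀ ⋖ s • p₀) (h₀ : w • s • p₀ < w • p₀) : w * s ∈ cutSubgroup α s := by
  intro p hp
  -- In type B, `s` may exchange two pairs; a descent at one is a descent at the other.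
  have hd : w • s • p < w • p := by
    have := A.reverses_congr hs w hp₀.lt.ne' hp.lt.ne'
    refine lt_of_le_of_ne (not_lt.1 fun h => ?_) fun e => hp.lt.ne' (MulAction.injective w e)
    exact h₀.not_gt ((this.2 (iff_of_true hp.lt h)).1 hp₀.lt)
  have hne : ∀ {x y : α}, x < y → w • x ≠ w • y := fun h e => h.ne (MulAction.injective w e)
  have lo : ∀ x, x < p → w • x < w • p := fun x hx =>
    lt_of_le_of_ne (not_lt.1 fun h => hw.1 x p (s • p) hx hp.lt hd h) (hne hx)
  have hi : ∀ y, s • p < y → w • s • p < w • y := fun y hy =>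
    lt_of_le_of_ne (not_lt.1 fun h => hw.1 p (s • p) y hp.lt hy h hd) (hne hy)
  have mid : ∀ x y, x < p → s • p < y → w • x < w • y := fun x y hx hy =>
    lt_of_le_of_ne (not_lt.1 fun h => hw.2 x p (s • p) y hx hp.lt hy (hi y hy) h (lo x hx))
      (hne (hx.trans (hp.lt.trans hy)))
  have key : ∀ x y, x ≤ p → p < y → (w * s) • x < (w * s) • y := by
    intro x y hx hy
    rw [mul_smul, mul_smul]
    have hy' : s • p ≤ y := not_lt.1 (hp.2 hy)
    rcases hx.eq_or_lt with rfl | hx <;> rcases hy'.eq_or_lt with rfl | hy'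
    · rwa [A.smul_smul_self hs]
    · exact hi _ (A.lt_smul_smul hs hp hy')
    · rw [A.smul_smul_self hs]
      exact lo _ (A.smul_smul_lt hs hp hx)
    · exact mid _ _ (A.smul_smul_lt hs hp hx) (A.lt_smul_smul hs hp hy')
  have inj := MulAction.injective (β := α) (w * s)
  have h1 : ∀ x, x ≤ p → (w * s) • x ≤ p := by
    intro x hx
    by_contra! h
    have hsub : (fun y : α => (w * s) • y) '' Set.Ioi p ⊂ Set.Ioi p := by
      refine ⟨?_, fun h2 => ?_⟩
      · rintro _ ⟨y, hy, rfl⟩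
        exact h.trans (key x y hx hy)
      · obtain ⟨y, hy, e⟩ := h2 h
        exact (hx.trans_lt hy).ne' (inj e)
    have := Set.ncard_lt_ncard hsub (Set.toFinite _)
    rw [Set.ncard_image_of_injective _ inj] at this
    exact this.false
  intro x
  refine ⟨fun h => ?_, h1 x⟩
  by_contra! hx
  have hsub : (fun y : α => (w * s) • y) '' Set.Iic p ⊂ Set.Iic p := by
    refine ⟨?_, fun h2 => ?_⟩
    · rintro _ ⟨y, hy, rfl⟩
      exact h1 y hy
    · obtain ⟨y, hy, e⟩ := h2 h
      exact (hy.trans_lt hx).ne (inj e)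
  have := Set.ncard_lt_ncard hsub (Set.toFinite _)
  rw [Set.ncard_image_of_injective _ inj] at this
  exact this.false

/-- An occurrence in which `s` exchanges no two consecutive positions is carried by `s` to one in
the other element. If `p` and `s • p` are consecutive positions, `u` keeps the two sides of the cut
apart, which contradicts an inequality of the pattern. -/
theorem avoidsBoth_mul_iff {s u : G} (hs : s ∈ S) (hu : u ∈ cutSubgroup α s) :
    AvoidsBoth (fun x : α => (u * s) • x) ↔ AvoidsBoth fun x : α => u • x := by
  have hlt : ∀ x y : α, x < y → s • x < s • y ∨ (x ⋖ s • x ∧ y = s • x) := by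
    intro x y hxy
    by_cases h : y = s • x
    · refine Or.inr ⟨?_, h⟩
      subst h
      exact (A.covBy s hs x hxy.ne').resolve_right fun h => h.lt.not_gt hxy
    · exact Or.inl (A.smul_lt_smul hs hxy h)
  have hlo : ∀ p : α, p ⋖ s • p → ∀ x, x ≤ p → u • x ≤ p := fun p hp x => (hu p hp x).2
  have hhi : ∀ p : α, p ⋖ s • p → ∀ x, p < x → p < u • x := fun p hp x h =>
    not_le.1 fun h1 => h.not_ge ((hu p hp x).1 h1)
  have hslo : ∀ p : α, p ⋖ s • p → ∀ x, x < p → s • x ≤ p := fun p hp x hx =>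
    (A.smul_smul_lt hs hp hx).le
  have hshi : ∀ p : α, p ⋖ s • p → ∀ x, s • p < x → p < s • x := fun p hp x hx =>
    hp.lt.trans (A.lt_smul_smul hs hp hx)
  have hss := fun x : α => A.smul_smul_self hs x
  simp only [AvoidsBoth, mul_smul]
  refine ⟨fun ⟨h1, h2⟩ => ⟨fun a b c hab hbc h3 h4 => ?_, fun a b c d hab hbc hcd h3 h4 h5 => ?_⟩,
    fun ⟨h1, h2⟩ => ⟨fun a b c hab hbc h3 h4 => ?_, fun a b c d hab hbc hcd h3 h4 h5 => ?_⟩⟩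
  · rcases hlt a b hab with hab' | ⟨hp, rfl⟩
    · rcases hlt b c hbc with hbc' | ⟨hp, rfl⟩
      · exact h1 _ _ _ hab' hbc' (by simpa only [hss] using h3) (by simpa only [hss] using h4)
      · exact h3.not_ge ((hlo b hp b le_rfl).trans (hhi b hp _ hbc).le)
    · exact (h3.trans h4).not_ge ((hlo a hp a le_rfl).trans (hhi a hp c (hab.trans hbc)).le)
  · rcases hlt a b hab with hab' | ⟨hp, rfl⟩
    · rcases hlt b c hbc with hbc' | ⟨hp, rfl⟩
      · rcases hlt c d hcd with hcd' | ⟨hp, rfl⟩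
        · exact h2 _ _ _ _ hab' hbc' hcd' (by simpa only [hss] using h3)
            (by simpa only [hss] using h4) (by simpa only [hss] using h5)
        · exact h4.not_ge ((hlo c hp a (hab.trans hbc).le).trans (hhi c hp _ hcd).le)
      · exact (h3.trans (h4.trans h5)).not_ge ((hlo b hp b le_rfl).trans (hhi b hp _ hbc).le)
    · exact (h3.trans h4).not_ge ((hlo a hp a le_rfl).trans (hhi a hp c (hab.trans hbc)).le)
  · rcases hlt a b hab with hab' | ⟨hp, rfl⟩
    · rcases hlt b c hbc with hbc' | ⟨hp, rfl⟩
      · exact h1 _ _ _ hab' hbc' h3 h4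
      · exact h4.not_ge ((hlo b hp _ (hslo b hp a hab)).trans (hhi b hp _ hbc).le)
    · rw [hss] at h3
      exact h3.not_ge ((hlo a hp a le_rfl).trans (hhi a hp _ (hshi a hp c hbc)).le)
  · rcases hlt a b hab with hab' | ⟨hp, rfl⟩
    · rcases hlt b c hbc with hbc' | ⟨hp, rfl⟩
      · rcases hlt c d hcd with hcd' | ⟨hp, rfl⟩
        · exact h2 _ _ _ _ hab' hbc' hcd' h3 h4 h5
        · rw [hss] at h3
          exact h3.not_ge ((hlo c hp c le_rfl).trans (hhi c hp _ hcd).le)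
      · exact h4.not_ge ((hlo b hp _ (hslo b hp a hab)).trans (hhi b hp _ (hshi b hp d hcd)).le)
    · rw [hss] at h5
      exact h5.not_ge ((hlo a hp a le_rfl).trans (hhi a hp _ hab).le)

theorem avoidsBoth_of_nodup [Finite α] [FaithfulSMul G α] {l : List G} (hl : ∀ x ∈ l, x ∈ S)
    (hd : l.Nodup) : AvoidsBoth fun x : α => l.prod • x := by
  induction l using List.reverseRecOn with
  | nil => simpa using avoidsBoth_one (G := G) (α := α)
  | append_singleton l s ih =>
    have hs := hl s (by simp)
    have hl' : ∀ x ∈ l, x ∈ S := fun x hx => hl x (by simp [hx])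
    rw [← List.concat_eq_append, List.nodup_concat] at hd
    rw [List.prod_append, List.prod_singleton]
    exact (A.avoidsBoth_mul_iff hs (A.inversionSystem.prod_mem_cut hl' hs hd.1)).2 (ih hl' hd.2)

/-- Induction on the number of generators whose cuts `w` violates. Removing a descent `s` repairs
the cuts of `s` and spoils no others; as `w * s` lies in `cutSubgroup α s`, its word does not
contain `s`. -/
theorem exists_nodup_of_avoidsBoth [Finite G] [Finite α] [FaithfulSMul G α] (w : G)
    (hw : AvoidsBoth fun x : α => w • x) :
    ∃ l : List G, (∀ x ∈ l, x ∈ S) ∧ l.Nodup ∧ l.prod = w := by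
  induction h : {s ∈ S | w ∉ cutSubgroup α s}.ncard using Nat.strong_induction_on
    generalizing w with
  | _ n ih =>
  by_cases hw1 : w = 1
  · exact ⟨[], by simp, List.nodup_nil, by simp [hw1]⟩
  obtain ⟨s, hs, p, hp, hd⟩ := A.exists_descent (α := α) hw1
  have hcut := A.mul_mem_cut hs hw hp hd
  have hss := A.mul_self s hs
  have hwss : w = w * s * s := by rw [mul_assoc, hss, mul_one]
  have hu : AvoidsBoth fun x : α => (w * s) • x := by
    rw [← A.avoidsBoth_mul_iff hs hcut, ← hwss]
    exact hw
  have hlt : {s' ∈ S | w * s ∉ cutSubgroup α s'}.ncard < n := by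
    rw [← h]
    refine Set.ncard_lt_ncard ⟨?_, fun hsub => ?_⟩ (Set.toFinite _)
    · rintro s' ⟨hs', h1⟩
      refine ⟨hs', fun h2 => h1 (mul_mem h2 (A.mem_cut_of_ne hs' hs ?_))⟩
      rintro rfl
      exact h1 hcut
    · refine (hsub ⟨hs, fun h1 => A.notMem_cut (α := α) hs ?_⟩).2 hcut
      exact (Subgroup.mul_mem_cancel_left _ h1).1 hcut
  obtain ⟨l, hl, hnd, h1⟩ := ih _ hlt (w * s) hu rfl
  refine ⟨l ++ [s], ?_, ?_, by rw [List.prod_append, h1, List.prod_singleton, ← hwss]⟩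
  · simp only [List.mem_append, List.mem_singleton]
    rintro x (hx | rfl)
    exacts [hl x hx, hs]
  · rw [← List.concat_eq_append, List.nodup_concat]
    refine ⟨fun h2 => ?_, hnd⟩
    refine (A.inversionSystem.mem_iff_of_nodup hl hnd hs).1 h2 ?_
    rw [h1]
    exact hcut

theorem isBooleanElement_iff [Finite G] [Finite α] [FaithfulSMul G α] (w : G) :
    IsBooleanElement S w ↔ AvoidsBoth fun x : α => w • x := by
  constructor
  · intro h
    obtain ⟨l, hl, hd, rfl⟩ := A.inversionSystem.nodup_of_isBooleanElement h
    exact A.avoidsBoth_of_nodup hl hd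
  · intro h
    obtain ⟨l, hl, hd, rfl⟩ := A.exists_nodup_of_avoidsBoth w h
    exact A.inversionSystem.isBooleanElement_of_nodup hl hd

end AdjacentGenerators

end AdjacentGenerators

/-! ### The symmetric group and the group of signed permutations -/

theorem hasPattern_perm321 {α : Type*} [LinearOrder α] (w : Equiv.Perm α) :
    HasPattern perm321 w ↔ ∃ a b c, a < b ∧ b < c ∧ w c < w b ∧ w b < w a := by
  constructor
  · rintro ⟨i, hi, h⟩
    exact ⟨i 0, i 1, i 2, hi (by decide), hi (by decide), (h 2 1).2 (by decide),
      (h 1 0).2 (by decide)⟩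
  · rintro ⟨a, b, c, hab, hbc, h1, h2⟩
    have h3 := h1.trans h2
    refine ⟨![a, b, c], ?_, ?_⟩
    · rw [Fin.strictMono_iff_lt_succ]
      intro i
      fin_cases i <;> simpa
    · intro x y
      fin_cases x <;> fin_cases y <;>
        simp [perm321, h1, h2, h3, h1.le, h2.le, h3.le]

theorem hasPattern_perm3412 {α : Type*} [LinearOrder α] (w : Equiv.Perm α) :
    HasPattern perm3412 w ↔
      ∃ a b c d, a < b ∧ b < c ∧ c < d ∧ w c < w d ∧ w d < w a ∧ w a < w b := by
  constructor
  · rintro ⟨i, hi, h⟩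
    exact ⟨i 0, i 1, i 2, i 3, hi (by decide), hi (by decide), hi (by decide),
      (h 2 3).2 (by decide), (h 3 0).2 (by decide), (h 0 1).2 (by decide)⟩
  · rintro ⟨a, b, c, d, hab, hbc, hcd, h1, h2, h3⟩
    have h4 := h1.trans h2
    have h5 := h2.trans h3
    have h6 := h4.trans h3
    refine ⟨![a, b, c, d], ?_, ?_⟩
    · rw [Fin.strictMono_iff_lt_succ]
      intro i
      fin_cases i <;> simpa
    · intro x y
      fin_cases x <;> fin_cases y <;>
        simp [perm3412, h1, h2, h3, h4, h5, h6, h1.le, h2.le, h3.le, h4.le, h5.le, h6.le]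

theorem avoidsBoth_iff {α : Type*} [LinearOrder α] (w : Equiv.Perm α) :
    AvoidsBoth w ↔ ¬ HasPattern perm321 w ∧ ¬ HasPattern perm3412 w := by
  rw [hasPattern_perm321, hasPattern_perm3412, AvoidsBoth]
  push Not
  rfl

/-! ### The two Coxeter groups as groups of neighbour exchanges -/

theorem adjacentGenerators_simpleA (n : ℕ) :
    AdjacentGenerators (α := Fin n) (simpleA n) id where
  mul_self := by
    rintro _ ⟨i, j, h, rfl⟩
    exact Equiv.swap_mul_self i j
  ne_one := by
    rintro _ ⟨i, j, h, rfl⟩ h1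
    have := Equiv.swap_eq_one_iff.1 h1
    subst this
    omega
  covBy := by
    rintro _ ⟨i, j, h, rfl⟩ x hx
    have hij : i ⋖ j := by rw [Fin.covBy_iff, Nat.covBy_iff_add_one_eq]; exact h
    simp only [Equiv.Perm.smul_def] at hx ⊢
    rcases (Equiv.swap_apply_ne_self_iff.1 hx).2 with rfl | rfl
    · simp [hij]
    · simp [hij]
  exists_smul_eq p q h := by
    rw [Fin.covBy_iff, Nat.covBy_iff_add_one_eq] at h
    exact ⟨_, ⟨p, q, h, rfl⟩, by simp⟩
  moved := by
    rintro _ ⟨i, j, h, rfl⟩ x y hx hy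
    simp only [Equiv.Perm.smul_def] at hx hy ⊢
    rcases (Equiv.swap_apply_ne_self_iff.1 hx).2 with rfl | rfl <;>
    rcases (Equiv.swap_apply_ne_self_iff.1 hy).2 with rfl | rfl <;> simp
  comm _ _ := rfl
  order _ _ _ _ _ _ := Iff.rfl

theorem val_simpleZero_smul {n : ℕ} (h : 0 < n) (x : SignedIndex n) :
    (simpleZero h • x).1 = if x.1 = 1 then -1 else if x.1 = -1 then 1 else x.1 := by
  simp only [simpleZero, Subgroup.smul_def, Equiv.Perm.smul_def,
    Equiv.swap_apply_def, apply_ite Subtype.val, Subtype.ext_iff, SignedIndex.val_neg, posIndex]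
  split_ifs <;> push_cast at * <;> omega

theorem val_simpleSucc_smul {n : ℕ} {i : ℕ} (h : i + 1 < n) (x : SignedIndex n) :
    (simpleSucc i h • x).1 = if x.1 = i + 1 then (i : ℤ) + 2 else if x.1 = i + 2 then (i : ℤ) + 1
      else if x.1 = -(i + 1) then -((i : ℤ) + 2) else if x.1 = -(i + 2) then -((i : ℤ) + 1)
      else x.1 := by
  have h0 := x.2.1
  simp only [simpleSucc, Subgroup.smul_def, Equiv.Perm.smul_def, Equiv.Perm.mul_apply,
    Equiv.swap_apply_def, apply_ite Subtype.val, Subtype.ext_iff, SignedIndex.val_neg, posIndex]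
  split_ifs <;> push_cast at * <;> omega

theorem signedIndex_covBy_iff {n : ℕ} {x y : SignedIndex n} :
    x ⋖ y ↔ x.1 + 1 = y.1 ∨ (x.1 = -1 ∧ y.1 = 1) := by
  obtain ⟨x, hx0, hx⟩ := x
  obtain ⟨y, hy0, hy⟩ := y
  rw [abs_le] at hx hy
  constructor
  · rintro ⟨h1, h2⟩
    simp only [Subtype.mk_lt_mk, Subtype.forall] at h1 h2 ⊢
    by_contra! h3
    by_cases h4 : x = -1
    · exact h2 1 ⟨by omega, abs_le.2 ⟨by omega, by omega⟩⟩ (by omega) (by omega)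
    · exact h2 (x + 1) ⟨by omega, abs_le.2 ⟨by omega, by omega⟩⟩ (by omega) (by omega)
  · intro h
    refine ⟨?_, ?_⟩
    · simp only [Subtype.mk_lt_mk] at h ⊢
      omega
    · rintro ⟨z, hz0, hz⟩ h1 h2
      simp only [Subtype.mk_lt_mk] at h h1 h2
      omega

instance finite_signedIndex (n : ℕ) : Finite (SignedIndex n) :=
  Finite.of_injective (β := Set.Icc (-(n : ℤ)) n) (fun x => ⟨x.1, abs_le.1 x.2.2⟩) fun x y h => by
    simpa [Subtype.ext_iff] using h

theorem adjacentGenerators_simpleB (n : ℕ) :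
    AdjacentGenerators (α := SignedIndex n) (simpleB n) (fun x => -x) where
  mul_self := by
    rintro _ (⟨h, rfl⟩ | ⟨i, h, rfl⟩) <;>
    refine FaithfulSMul.eq_of_smul_eq_smul (α := SignedIndex n) fun x => Subtype.ext ?_ <;>
    rw [mul_smul, one_smul]
    · have h1 := val_simpleZero_smul h x
      have h2 := val_simpleZero_smul h (simpleZero h • x)
      split_ifs at h1 h2 <;> omega
    · have h1 := val_simpleSucc_smul h x
      have h2 := val_simpleSucc_smul h (simpleSucc i h • x)
      split_ifs at h1 h2 <;> omega
  ne_one := by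
    rintro _ (⟨h, rfl⟩ | ⟨i, h, rfl⟩) h1
    · have := val_simpleZero_smul h (posIndex 0 h)
      rw [h1, one_smul] at this
      simp [posIndex] at this
    · have := val_simpleSucc_smul h (posIndex i (by omega))
      rw [h1, one_smul] at this
      simp [posIndex] at this
  covBy := by
    rintro _ (⟨h, rfl⟩ | ⟨i, h, rfl⟩) x hx <;>
    simp only [ne_eq, Subtype.ext_iff, signedIndex_covBy_iff, val_simpleZero_smul,
      val_simpleSucc_smul] at hx ⊢ <;> split_ifs at hx ⊢ <;> omega
  exists_smul_eq p q h := by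
    rw [signedIndex_covBy_iff] at h
    have hp0 := p.2.1
    have hq0 := q.2.1
    have hp := abs_le.1 p.2.2
    have hq := abs_le.1 q.2.2
    by_cases h0 : p.1 = -1
    · refine ⟨_, Or.inl ⟨by omega, rfl⟩, Subtype.ext ?_⟩
      rw [val_simpleZero_smul]
      split_ifs <;> omega
    by_cases hpos : 0 < p.1
    · refine ⟨_, Or.inr ⟨(p.1 - 1).toNat, by omega, rfl⟩, Subtype.ext ?_⟩
      rw [val_simpleSucc_smul]
      split_ifs <;> omega
    -- On the negative side, `q = -(i + 1)` and `p = -(i + 2)`, so the index is read from `q`.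
    · refine ⟨_, Or.inr ⟨(-q.1 - 1).toNat, by omega, rfl⟩, Subtype.ext ?_⟩
      rw [val_simpleSucc_smul]
      split_ifs <;> omega
  moved := by
    rintro _ (⟨h, rfl⟩ | ⟨i, h, rfl⟩) x y hx hy <;>
    simp only [ne_eq, Subtype.ext_iff, val_simpleZero_smul, val_simpleSucc_smul,
      SignedIndex.val_neg] at hx hy ⊢ <;> split_ifs at hx hy ⊢ <;> omega
  comm g x := (g.2 x).symm
  order a b c d hab hcd := by
    rw [ne_eq, Subtype.ext_iff] at hab hcd
    simp only [← Subtype.coe_lt_coe, SignedIndex.val_neg]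
    omega

theorem mainTheorem1 :
    (∀ (n : ℕ) (w : SignedPerm n),
      IsBooleanElement (simpleB n) w ↔ GloballyAvoids perm321 w ∧ GloballyAvoids perm3412 w) ∧
    (∀ (n : ℕ) (w : Equiv.Perm (Fin n)),
      IsBooleanElement (simpleA n) w ↔ Avoids perm321 w ∧ Avoids perm3412 w) ∧
    IsPersistent (fun n w => IsBooleanElement (simpleA n) w)
      (fun n w => IsBooleanElement (simpleB n) w) := by
  have hB : ∀ (n : ℕ) (w : SignedPerm n), IsBooleanElement (simpleB n) w ↔
      GloballyAvoids perm321 w ∧ GloballyAvoids perm3412 w := fun n w =>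
    ((adjacentGenerators_simpleB n).isBooleanElement_iff w).trans (avoidsBoth_iff w.1)
  have hA : ∀ (n : ℕ) (w : Equiv.Perm (Fin n)), IsBooleanElement (simpleA n) w ↔
      Avoids perm321 w ∧ Avoids perm3412 w := fun n w =>
    ((adjacentGenerators_simpleA n).isBooleanElement_iff w).trans (avoidsBoth_iff w)
  refine ⟨hB, hA, {⟨3, perm321⟩, ⟨4, perm3412⟩}, fun n w => ?_, fun n w => ?_⟩
  · simp [hA]
  · simp [hB]
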